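/- Let $(P,\sigma)$ be an $n$-dimensional symplectic manifold, let $\mathbb K=\mathbb R$ or $\mathbb C$, let $C^\infty(P)$ be the $\mathbb K$-algebra of smooth functions $P\to\mathbb K$, and let $[\,\cdot\,,\cdot\,]$ be the Poisson bracket. Let $G_1,\dots,G_M$ be real smooth (that is, Bosonic) functions on $P$ which are first class constraints, $[G_a,G_b]=C_{ab}^{c}G_c$ with $C_{ab}^c\in C^\infty(P)$, and irreducible: their differentials are linearly independent at each point of $\{G_1=\dots=G_M=0\}$. Put $X_af=[f,G_a]$. Let $\Omega=\mathbb K[P_a]\otimes C^\infty(P)\otimes \mathbb K[\eta^b]$ $(a,b=1,\dots,M)$ with odd antighosts $P_a$ and odd ghosts $\eta^b$, i.e. the exterior algebra over $C^\infty(P)$ on these $2M$ generators. The pure ghost number is the degree in the $\eta^b$, the antighost number is the degree in the $P_a$, and the ghost number is the difference of the two. A differential on $\Omega$ is a $\mathbb K$-linear map $S$ with $S^2=0$ which raises the ghost number by one and satisfies $S(xy)=(Sx)y+(-1)^{\mathrm{gh}(x)}x\,Sy$. A BRST differential is a differential on $\Omega$ of the form $S=\delta+d+s_1+s_2+\cdots$,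 all summands being odd derivations, where $\delta$ is the Koszul–Tate differential ($\delta P_a=-G_a$, $\delta f=0$, $\delta\eta^a=0$), $d$ preserves the antighost number and is the longitudinal differential on $C^\infty(P)\otimes\mathbb K[\eta^b]$ ($df=(X_af)\eta^a$, $d\eta^a=-\frac12C_{cb}^{a}\eta^b\eta^c$), and $s_k$ raises the antighost number by $k$. The multi-ghosts are the elements $\omega^I=\eta^{b_1}\cdots\eta^{b_{p+1}}P_{a_p}\cdots P_{a_1}$, where $I=(b_1<\dots<b_{p+1},\,a_1<\dots<a_p)$ and $p\ge 0$. **Theorem.** Every BRST differential $S$ is a Maurer–Cartan differential with respect to the multi-ghosts: it is a differential, and there are derivations $\rho_I$ of $C^\infty(P)$ and functions $C_{IJ}^K\in C^\infty(P)$ with $C_{IJ}^K=-C_{JI}^K$ such that $$Sf=\sum_I(\rho_If)\,\omega^I\quad (f\in C^\infty(P)),\qquad S\omega^K=-\tfrac12\sum_{I,J}C_{IJ}^K\,\omega^I\omega^J\quad\text{for all }K.$$ -/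

import Mathlib

open scoped Manifold ContDiff

noncomputable section

namespace BRST

/-! ### Smooth functions and symplectic forms on an `n`-dimensional manifold -/

section Manifold

/-- The `𝕜`-algebra `C^∞(P)` of smooth functions `P → 𝕜` (`𝕜 = ℝ` or `ℂ`) on a real manifold `P`. -/
def smoothFunctions (n : ℕ) (P : Type*) [TopologicalSpace P]
    [ChartedSpace (EuclideanSpace ℝ (Fin n)) P] (𝕜 : Type*) [RCLike 𝕜] : Subalgebra 𝕜 (P → 𝕜) where
  carrier := {f | ContMDiff (𝓡 n) 𝓘(ℝ, 𝕜) ∞ f}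
  mul_mem' hf hg := contDiff_mul.comp_contMDiff (hf.prodMk_space hg)
  add_mem' hf hg := hf.add hg
  algebraMap_mem' _ := contMDiff_const

variable {n : ℕ} {P : Type*} [TopologicalSpace P] [ChartedSpace (EuclideanSpace ℝ (Fin n)) P]

/-- The expression of a field of 2-forms in the chart around `x₀`: its pullback under the inverse
of the chart. -/
def inChart (σ : ∀ x : P, TangentSpace (𝓡 n) x [⋀^Fin 2]→L[ℝ] ℝ) (x₀ : P)
    (y : EuclideanSpace ℝ (Fin n)) : EuclideanSpace ℝ (Fin n) [⋀^Fin 2]→L[ℝ] ℝ :=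
  (σ ((extChartAt (𝓡 n) x₀).symm y)).compContinuousLinearMap
    (mfderiv 𝓘(ℝ, EuclideanSpace ℝ (Fin n)) (𝓡 n) (extChartAt (𝓡 n) x₀).symm y)

/-- A symplectic form: a smooth, closed, nondegenerate 2-form. -/
structure SymplecticForm (n : ℕ) (P : Type*) [TopologicalSpace P]
    [ChartedSpace (EuclideanSpace ℝ (Fin n)) P] where
  /-- the value of the form at a point -/
  form : ∀ x : P, TangentSpace (𝓡 n) x [⋀^Fin 2]→L[ℝ] ℝ
  nondegenerate : ∀ (x : P) (v : TangentSpace (𝓡 n) x), (∀ w, form x ![v, w] = 0) → v = 0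
  smooth : ∀ x₀ : P, ContDiffOn ℝ ∞ (inChart form x₀) (extChartAt (𝓡 n) x₀).target
  closed : ∀ x₀ : P, ∀ y ∈ (extChartAt (𝓡 n) x₀).target, extDeriv (inChart form x₀) y = 0

/-- The continuous linear map sending an alternating form `a` to `v ↦ (w ↦ a (v, w))`. -/
def curryTwo (E : Type*) [NormedAddCommGroup E] [NormedSpace ℝ E] :
    (E [⋀^Fin 2]→L[ℝ] ℝ) →L[ℝ] (E →L[ℝ] E →L[ℝ] ℝ) :=
  ((continuousMultilinearCurryFin1 ℝ E ℝ).toContinuousLinearEquiv.toContinuousLinearMap.postcomp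
    E).comp
    ((continuousMultilinearCurryLeftEquiv ℝ
      (fun _ : Fin 2 => E) ℝ).toContinuousLinearEquiv.toContinuousLinearMap.comp
        (ContinuousAlternatingMap.toContinuousMultilinearMapCLM ℝ))

theorem curryTwo_apply {E : Type*} [NormedAddCommGroup E] [NormedSpace ℝ E]
    (a : E [⋀^Fin 2]→L[ℝ] ℝ) (v w : E) : curryTwo E a v w = a ![v, w] := by
  simp only [curryTwo, ContinuousLinearMap.comp_apply]
  change a (Fin.cons v (Fin.snoc 0 w)) = _
  congr 1
  ext i
  fin_cases i <;> rfl



theorem contDiff_curryTwo (E : Type*) [NormedAddCommGroup E] [NormedSpace ℝ E] :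
    ContDiff ℝ ∞ (fun a : E [⋀^Fin 2]→L[ℝ] ℝ => curryTwo E a) :=
  ContinuousLinearMap.contDiff (𝕜 := ℝ) (E := E [⋀^Fin 2]→L[ℝ] ℝ) (F := E →L[ℝ] E →L[ℝ] ℝ)
    (curryTwo E)

/-- Every covector is represented by a unique tangent vector through the symplectic form. -/
theorem SymplecticForm.existsUnique_vector (σ : SymplecticForm n P) (x : P)
    (α : TangentSpace (𝓡 n) x →L[ℝ] ℝ) :
    ∃! v : TangentSpace (𝓡 n) x, ∀ w, σ.form x ![v, w] = -α w := by
  let B : EuclideanSpace ℝ (Fin n) →L[ℝ] EuclideanSpace ℝ (Fin n) →L[ℝ] ℝ :=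
    curryTwo (EuclideanSpace ℝ (Fin n)) (σ.form x)
  have hB : ∀ v w, B v w = σ.form x ![v, w] := fun v w => curryTwo_apply _ v w
  let B' : EuclideanSpace ℝ (Fin n) →ₗ[ℝ] (EuclideanSpace ℝ (Fin n) →ₗ[ℝ] ℝ) :=
    LinearMap.mk₂ ℝ (fun v w => B v w) (by simp) (by simp) (by simp) (by simp)
  have hinj : Function.Injective B' := by
    rw [injective_iff_map_eq_zero]
    intro v hv
    refine σ.nondegenerate x v fun w => ?_
    exact (hB v w).symm.trans (LinearMap.congr_fun hv w)
  have hsurj : Function.Surjective B' :=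
    (LinearMap.injective_iff_surjective_of_finrank_eq_finrank
      (Subspace.dual_finrank_eq (K := ℝ) (V := EuclideanSpace ℝ (Fin n))).symm).1 hinj
  obtain ⟨v, hv⟩ := hsurj (-(α : EuclideanSpace ℝ (Fin n) →L[ℝ] ℝ).toLinearMap)
  refine ⟨v, fun w => ?_, fun v' hv' => ?_⟩
  · exact (hB v w).symm.trans (LinearMap.congr_fun hv w)
  · apply hinj
    rw [hv]
    ext w
    exact (hB v' w).trans (hv' w)

/-- The Hamiltonian vector field `X_g` of a real function `g`, given by `σ (X_g, w) = - dg (w)`. -/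
def SymplecticForm.hamiltonianField (σ : SymplecticForm n P) (g : P → ℝ) (x : P) :
    TangentSpace (𝓡 n) x :=
  (σ.existsUnique_vector x (mfderiv (𝓡 n) 𝓘(ℝ, ℝ) g x)).choose

theorem SymplecticForm.hamiltonianField_spec (σ : SymplecticForm n P) (g : P → ℝ) (x : P)
    (w : TangentSpace (𝓡 n) x) :
    σ.form x ![σ.hamiltonianField g x, w] = -(mfderiv (𝓡 n) 𝓘(ℝ, ℝ) g x w) :=
  (σ.existsUnique_vector x (mfderiv (𝓡 n) 𝓘(ℝ, ℝ) g x)).choose_spec.1 w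

theorem SymplecticForm.contMDiff_bracket [IsManifold (𝓡 n) ∞ P] {𝕜 : Type*} [RCLike 𝕜]
    (σ : SymplecticForm n P) {f : P → 𝕜} {g : P → ℝ}
    (hf : ContMDiff (𝓡 n) 𝓘(ℝ, 𝕜) ∞ f) (hg : ContMDiff (𝓡 n) 𝓘(ℝ, ℝ) ∞ g) :
    ContMDiff (𝓡 n) 𝓘(ℝ, 𝕜) ∞
      (fun x => (mfderiv (𝓡 n) 𝓘(ℝ, 𝕜) f x (σ.hamiltonianField g x) : 𝕜)) := by
  intro x₀
  let E := EuclideanSpace ℝ (Fin n)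
  let φ := extChartAt (𝓡 n) x₀
  have hopen : IsOpen φ.target := isOpen_extChartAt_target x₀
  have hφs : ∀ y ∈ φ.target, ContMDiffAt 𝓘(ℝ, E) (𝓡 n) ∞ φ.symm y := fun y hy =>
    (contMDiffOn_extChartAt_symm x₀).contMDiffAt (hopen.mem_nhds hy)
  have hf' : ∀ y ∈ φ.target, ContDiffAt ℝ ∞ (f ∘ φ.symm) y := fun y hy =>
    ((hf _).comp y (hφs y hy)).contDiffAt
  have hg' : ∀ y ∈ φ.target, ContDiffAt ℝ ∞ (g ∘ φ.symm) y := fun y hy =>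
    ((hg _).comp y (hφs y hy)).contDiffAt
  let T : ∀ y : E, E →L[ℝ] TangentSpace (𝓡 n) (φ.symm y) := fun y =>
    mfderiv 𝓘(ℝ, E) (𝓡 n) φ.symm y
  have hT : ∀ y ∈ φ.target, Function.Surjective (T y) := by
    intro y hy v
    have h := mfderivWithin_extChartAt_symm_comp_mfderiv_extChartAt (I := 𝓡 n) hy
    rw [ModelWithCorners.range_eq_univ, mfderivWithin_univ] at h
    exact ⟨_, congrArg (fun L => L v) h⟩
  have hTi : ∀ y ∈ φ.target, Function.Injective (T y) := by
    intro y hy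
    exact (LinearMap.injective_iff_surjective (V := E) (f := (T y).toLinearMap)).2 (hT y hy)
  have hdf : ∀ y ∈ φ.target, ∀ v, fderiv ℝ (f ∘ φ.symm) y v =
      mfderiv (𝓡 n) 𝓘(ℝ, 𝕜) f (φ.symm y) (T y v) := by
    intro y hy v
    rw [← mfderiv_eq_fderiv, mfderiv_comp y ((hf _).mdifferentiableAt (by simp))
      ((hφs y hy).mdifferentiableAt (by simp))]
    rfl
  have hdg : ∀ y ∈ φ.target, ∀ v, fderiv ℝ (g ∘ φ.symm) y v =
      mfderiv (𝓡 n) 𝓘(ℝ, ℝ) g (φ.symm y) (T y v) := by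
    intro y hy v
    rw [← mfderiv_eq_fderiv, mfderiv_comp y ((hg _).mdifferentiableAt (by simp))
      ((hφs y hy).mdifferentiableAt (by simp))]
    rfl
  let B : E → E →L[ℝ] E →L[ℝ] ℝ := fun y => curryTwo E (inChart σ.form x₀ y)
  have hB : ∀ y v w, B y v w = σ.form (φ.symm y) ![T y v, T y w] := by
    intro y v w
    rw [curryTwo_apply]
    change σ.form (φ.symm y) _ = _
    congr 1
    ext i
    fin_cases i <;> rfl
  have hBinj : ∀ y ∈ φ.target, Function.Injective (B y) := by
    intro y hy
    rw [injective_iff_map_eq_zero]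
    intro v hv
    apply hTi y hy
    rw [map_zero]
    refine σ.nondegenerate _ _ fun w => ?_
    obtain ⟨w, rfl⟩ := hT y hy w
    rw [← hB, hv]
    rfl
  have hBinv : ∀ y ∈ φ.target, (B y).IsInvertible := by
    intro y hy
    have hr : Module.finrank ℝ E = Module.finrank ℝ (E →L[ℝ] ℝ) := by
      rw [← (LinearMap.toContinuousLinearMap (𝕜 := ℝ) (E := E) (F' := ℝ)).finrank_eq]
      exact (Subspace.dual_finrank_eq (K := ℝ) (V := E)).symm
    exact ⟨(LinearEquiv.ofInjectiveOfFinrankEq (B y).toLinearMap (hBinj y hy)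
      hr).toContinuousLinearEquiv, by ext; rfl⟩
  have hBs : ∀ y ∈ φ.target, ContDiffAt ℝ ∞ B y := fun y hy =>
    (contDiff_curryTwo E).contDiffAt.comp y ((σ.smooth x₀).contDiffAt (hopen.mem_nhds hy))
  let u : E → 𝕜 := fun y =>
    fderiv ℝ (f ∘ φ.symm) y ((B y).inverse (-(fderiv ℝ (g ∘ φ.symm) y)))
  have hu : ∀ y ∈ φ.target, ContDiffAt ℝ ∞ u y := by
    intro y hy
    refine ((hf' y hy).fderiv_right (m := ∞) (by simp)).clm_apply
      (ContDiffAt.clm_apply ?_ ((hg' y hy).fderiv_right (m := ∞) (by simp)).neg)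
    exact (hBinv y hy).contDiffAt_map_inverse.comp y (hBs y hy)
  have hux : ∀ y ∈ φ.target, (mfderiv (𝓡 n) 𝓘(ℝ, 𝕜) f (φ.symm y)
      (σ.hamiltonianField g (φ.symm y)) : 𝕜) = u y := by
    intro y hy
    obtain ⟨v, hv⟩ := hT y hy (σ.hamiltonianField g (φ.symm y))
    have h1 : B y v = -(fderiv ℝ (g ∘ φ.symm) y) := by
      ext w
      rw [hB, hv, σ.hamiltonianField_spec]
      exact congrArg Neg.neg (hdg y hy w).symm
    have h2 : (B y).inverse (-(fderiv ℝ (g ∘ φ.symm) y)) = v := by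
      rw [← h1]
      exact (hBinv y hy).inverse_apply_eq.2 rfl
    rw [← hv]
    change _ = fderiv ℝ (f ∘ φ.symm) y _
    rw [h2]
    exact (hdf y hy v).symm
  have hx₀ : x₀ ∈ φ.source := mem_extChartAt_source x₀
  have hc : ContMDiffAt (𝓡 n) 𝓘(ℝ, 𝕜) ∞ (u ∘ φ) x₀ :=
    (hu _ (φ.map_source hx₀)).contMDiffAt.comp x₀ contMDiffAt_extChartAt
  refine hc.congr_of_eventuallyEq ?_
  filter_upwards [extChartAt_source_mem_nhds (I := 𝓡 n) x₀] with x hx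
  have := hux (φ x) (φ.map_source hx)
  rw [φ.left_inv hx] at this
  exact this

/-- The type of elements of `C^∞(P)`. -/
def SmoothFun (n : ℕ) (P : Type*) [TopologicalSpace P] [ChartedSpace (EuclideanSpace ℝ (Fin n)) P]
    (𝕜 : Type*) [RCLike 𝕜] : Type _ :=
  smoothFunctions n P 𝕜

instance {𝕜 : Type*} [RCLike 𝕜] : CommRing (SmoothFun n P 𝕜) :=
  inferInstanceAs (CommRing (smoothFunctions n P 𝕜))

instance {𝕜 : Type*} [RCLike 𝕜] : Algebra 𝕜 (SmoothFun n P 𝕜) :=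
  inferInstanceAs (Algebra 𝕜 (smoothFunctions n P 𝕜))

end Manifold

variable {n : ℕ} {P : Type*} [TopologicalSpace P] [ChartedSpace (EuclideanSpace ℝ (Fin n)) P]
  {𝕜 : Type*} [RCLike 𝕜] {M : ℕ}

/-- A real smooth function, regarded as a `𝕜`-valued one. -/
def ofReal (n : ℕ) {P : Type*} [TopologicalSpace P] [ChartedSpace (EuclideanSpace ℝ (Fin n)) P]
    (𝕜 : Type*) [RCLike 𝕜] (g : SmoothFun n P ℝ) : SmoothFun n P 𝕜 :=
  ⟨fun x => (g.1 x : 𝕜), (RCLike.ofRealCLM (K := 𝕜)).contDiff.comp_contMDiff g.2⟩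

/-- The Poisson bracket `[f, g] = X_g f` with a real function `g`. -/
def SymplecticForm.bracket [IsManifold (𝓡 n) ∞ P] (σ : SymplecticForm n P)
    (f : SmoothFun n P 𝕜) (g : SmoothFun n P ℝ) : SmoothFun n P 𝕜 :=
  ⟨fun x => (mfderiv (𝓡 n) 𝓘(ℝ, 𝕜) f.1 x (σ.hamiltonianField g.1 x) : 𝕜),
    σ.contMDiff_bracket f.2 g.2⟩

/-! ### Constraints -/

/-- The constraints `G` are first class with structure functions `C a b c = C_{ab}^c`:
`[G_a, G_b] = C_{ab}^c G_c`. -/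
def IsFirstClass [IsManifold (𝓡 n) ∞ P] (σ : SymplecticForm n P)
    (G : Fin M → SmoothFun n P ℝ) (C : Fin M → Fin M → Fin M → SmoothFun n P 𝕜) :
    Prop :=
  ∀ a b, ofReal n 𝕜 (σ.bracket (G a) (G b)) = ∑ c, C a b c * ofReal n 𝕜 (G c)

/-- The constraints `G` are irreducible: their differentials are linearly independent at each point
of the constraint surface. -/
def IsIrreducible (G : Fin M → SmoothFun n P ℝ) : Prop :=
  ∀ x : P, (∀ a, (G a).1 x = 0) →
    LinearIndependent ℝ fun a =>
      show TangentSpace (𝓡 n) x →L[ℝ] ℝ from mfderiv (𝓡 n) 𝓘(ℝ, ℝ) (G a).1 x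

/-! ### The complex `C[P_a] ⊗ C^∞(P) ⊗ C[η^b]`

For bosonic constraints all the antighosts `P_a` and ghosts `η^b` are odd, so that the complex is
the exterior algebra over `C^∞(P)` on the `2 M` generators `P_a` and `η^b`. -/

/-- The complex `C[P_a] ⊗ C^∞(P) ⊗ C[η^b]` for `M` bosonic constraints. -/
abbrev GhostComplex (n : ℕ) (P : Type*) [TopologicalSpace P]
    [ChartedSpace (EuclideanSpace ℝ (Fin n)) P] (𝕜 : Type*) [RCLike 𝕜] (M : ℕ) : Type _ :=
  ExteriorAlgebra (SmoothFun n P 𝕜) (Fin M ⊕ Fin M → SmoothFun n P 𝕜)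

/-- A function as an element of the complex. -/
def ofFun (M : ℕ) (f : SmoothFun n P 𝕜) : GhostComplex n P 𝕜 M :=
  algebraMap (SmoothFun n P 𝕜) (GhostComplex n P 𝕜 M) f

variable (n P 𝕜) in
/-- The antighost `P_a`. -/
def antighost (a : Fin M) : GhostComplex n P 𝕜 M :=
  ExteriorAlgebra.ι (SmoothFun n P 𝕜) (Pi.single (Sum.inl a) 1)

variable (n P 𝕜) in
/-- The ghost `η^b`. -/
def ghost (b : Fin M) : GhostComplex n P 𝕜 M :=
  ExteriorAlgebra.ι (SmoothFun n P 𝕜) (Pi.single (Sum.inr b) 1)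

variable (n P 𝕜 M) in
/-- The elements of degree `p` in the ghosts and of degree `q` in the antighosts, i.e. of pure ghost
number `p` and antighost number `q`. -/
def bidegree (p q : ℕ) : Submodule (SmoothFun n P 𝕜) (GhostComplex n P 𝕜 M) :=
  Submodule.span _ {x | ∃ (b : Fin p → Fin M) (a : Fin q → Fin M),
    x = (List.ofFn fun i => ghost n P 𝕜 (b i)).prod *
      (List.ofFn fun i => antighost n P 𝕜 (a i)).prod}

variable (n P 𝕜 M) in
/-- The elements of antighost number `q`. -/
def antighostNumber (q : ℕ) : Submodule (SmoothFun n P 𝕜) (GhostComplex n P 𝕜 M) :=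
  ⨆ p : ℕ, bidegree n P 𝕜 M p q

variable (n P 𝕜 M) in
/-- The elements of ghost number `g`, the pure ghost number minus the antighost number. -/
def ghostNumber (g : ℤ) : Submodule (SmoothFun n P 𝕜) (GhostComplex n P 𝕜 M) :=
  ⨆ (p : ℕ) (q : ℕ) (_ : (p : ℤ) - q = g), bidegree n P 𝕜 M p q

/-! ### Differentials -/

/-- The graded Leibniz rule `D (x y) = (D x) y + (-1)^{gh x} x (D y)`. (The parity of an element is
that of its ghost number.) -/
def IsOddDerivation (D : GhostComplex n P 𝕜 M →ₗ[𝕜] GhostComplex n P 𝕜 M) : Prop :=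
  ∀ (g : ℤ), ∀ x ∈ ghostNumber n P 𝕜 M g, ∀ y,
    D (x * y) = D x * y + (g.negOnePow : ℤ) • (x * D y)

/-- A differential on the complex: an odd derivation of ghost number one and of square zero. -/
structure IsDifferential (S : GhostComplex n P 𝕜 M →ₗ[𝕜] GhostComplex n P 𝕜 M) : Prop where
  leibniz : IsOddDerivation S
  ghostNumber : ∀ (g : ℤ), ∀ x ∈ ghostNumber n P 𝕜 M g, S x ∈ ghostNumber n P 𝕜 M (g + 1)
  sq_eq_zero : ∀ x, S (S x) = 0

/-- The Koszul-Tate differential: the odd derivation with `δ P_a = - G_a`, `δ f = 0` and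
`δ η^a = 0`. -/
structure IsKoszulTate (G : Fin M → SmoothFun n P ℝ)
    (δ : GhostComplex n P 𝕜 M →ₗ[𝕜] GhostComplex n P 𝕜 M) : Prop where
  leibniz : IsOddDerivation δ
  apply_antighost : ∀ a, δ (antighost n P 𝕜 a) = -ofFun M (ofReal n 𝕜 (G a))
  apply_fun : ∀ f, δ (ofFun M f) = 0
  apply_ghost : ∀ a, δ (ghost n P 𝕜 a) = 0

/-- An extension to the whole complex, as an odd derivation of antighost number zero, of the
longitudinal differential `d f = (X_a f) η^a`, `d η^a = - 1/2 C_{cb}^a η^b η^c`, where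
`X_a f = [f, G_a]`. Its values on the antighosts are not prescribed. -/
structure IsLongitudinal [IsManifold (𝓡 n) ∞ P] (σ : SymplecticForm n P)
    (G : Fin M → SmoothFun n P ℝ) (C : Fin M → Fin M → Fin M → SmoothFun n P 𝕜)
    (d : GhostComplex n P 𝕜 M →ₗ[𝕜] GhostComplex n P 𝕜 M) : Prop where
  leibniz : IsOddDerivation d
  antighostNumber : ∀ q, ∀ x ∈ antighostNumber n P 𝕜 M q, d x ∈ antighostNumber n P 𝕜 M q
  apply_fun : ∀ f, d (ofFun M f) = ∑ a, σ.bracket f (G a) • ghost n P 𝕜 a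
  apply_ghost : ∀ a, d (ghost n P 𝕜 a) =
    -((1 / 2 : 𝕜) • ∑ b, ∑ c, C c b a • (ghost n P 𝕜 b * ghost n P 𝕜 c))

/-- `S` is a BRST differential of the constraints `G` with structure functions `C`: a differential
with an expansion `S = δ + d + s_1 + s_2 + ⋯`, where `δ` is the Koszul-Tate differential, `d` is the
longitudinal differential, and `s_k` is an odd derivation raising the antighost number by `k` (no
element has an antighost number greater than `M`, so the expansion stops at `s_M`). -/
structure IsBRSTDifferential [IsManifold (𝓡 n) ∞ P] (σ : SymplecticForm n P)
    (G : Fin M → SmoothFun n P ℝ) (C : Fin M → Fin M → Fin M → SmoothFun n P 𝕜)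
    (S : GhostComplex n P 𝕜 M →ₗ[𝕜] GhostComplex n P 𝕜 M) : Prop where
  isDifferential : IsDifferential S
  expansion : ∃ (δ d : GhostComplex n P 𝕜 M →ₗ[𝕜] GhostComplex n P 𝕜 M)
    (s : ℕ → GhostComplex n P 𝕜 M →ₗ[𝕜] GhostComplex n P 𝕜 M),
    IsKoszulTate G δ ∧ IsLongitudinal σ G C d ∧
    (∀ k, IsOddDerivation (s k) ∧ ∀ q, ∀ x ∈ antighostNumber n P 𝕜 M q,
      s k x ∈ antighostNumber n P 𝕜 M (q + k)) ∧
    ∀ x, S x = δ x + d x + ∑ k ∈ Finset.Icc 1 M, s k x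

/-! ### Multi-ghosts -/

/-- The multi-indices `(b_1 < ⋯ < b_{p+1}, a_1 < ⋯ < a_p)`, as pairs of finite sets. -/
abbrev MultiIndex (M : ℕ) : Type :=
  {I : Finset (Fin M) × Finset (Fin M) // I.1.card = I.2.card + 1}

variable (n P 𝕜) in
/-- The multi-ghost `ω^I = η^{b_1} ⋯ η^{b_{p+1}} P_{a_p} ⋯ P_{a_1}`. -/
def multiGhost (I : MultiIndex M) : GhostComplex n P 𝕜 M :=
  ((I.1.1.sort (· ≤ ·)).map (ghost n P 𝕜)).prod *
    ((I.1.2.sort (· ≤ ·)).reverse.map (antighost n P 𝕜)).prod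

/-- `S` is a Maurer-Cartan differential with respect to the multi-ghosts: a differential such that
`S f = (ρ_I f) ω^I` and `S ω^K = - 1/2 C_{IJ}^K ω^I ω^J` for derivations `ρ_I` of `C^∞(P)` and
functions `C I J K = C_{IJ}^K` antisymmetric in `I` and `J`. -/
def IsMaurerCartan (S : GhostComplex n P 𝕜 M →ₗ[𝕜] GhostComplex n P 𝕜 M) : Prop :=
  IsDifferential S ∧
  ∃ (ρ : MultiIndex M → Derivation 𝕜 (SmoothFun n P 𝕜) (SmoothFun n P 𝕜))
    (C : MultiIndex M → MultiIndex M → MultiIndex M → SmoothFun n P 𝕜),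
    (∀ I J K, C I J K = -C J I K) ∧
    (∀ f, S (ofFun M f) = ∑ I, ρ I f • multiGhost n P 𝕜 I) ∧
    ∀ K, S (multiGhost n P 𝕜 K) =
      -((1 / 2 : 𝕜) • ∑ I, ∑ J, C I J K • (multiGhost n P 𝕜 I * multiGhost n P 𝕜 J))

end BRST

end

/-!
The result is a consequence of counting degrees. A differential `S` raises the ghost number by one,
so `S f` has ghost number one for a function `f`, and `S ω^K` has ghost number two.

The multi-ghosts `ω^I` form a basis, over `C^∞(P)`, of the elements of ghost number one
(`BRST.ghostNumber_one_le_span`, `BRST.exists_dual_multiGhost`). Hence `S f = (ρ_I f) ω^I` with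
uniquely determined coefficients, and the Leibniz rule for `S` on products of functions says that
the `ρ_I` are derivations.

A monomial of ghost number two has at least two ghosts. Splitting off the first of them, which is
itself a multi-ghost, leaves a monomial of ghost number one, which is a multi-ghost up to sign. So
the products `ω^I ω^J` span the elements of ghost number two (`BRST.ghostNumber_two_le_span`), and
`S ω^K` is a combination of them. Since the multi-ghosts anticommute
(`BRST.multiGhost_mul_comm`), the coefficients can be antisymmetrized.
-/

namespace BRST

/-! ### Monomials in an exterior algebra -/

section Exterior

variable {R V α : Type*} [CommRing R] [AddCommGroup V] [Module R V]

theorem prod_map_ι_eq_or_neg_of_perm (v : α → V) {l l' : List α} (h : l.Perm l') :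
    (l.map fun x => ExteriorAlgebra.ι R (v x)).prod =
        (l'.map fun x => ExteriorAlgebra.ι R (v x)).prod ∨
      (l.map fun x => ExteriorAlgebra.ι R (v x)).prod =
        -(l'.map fun x => ExteriorAlgebra.ι R (v x)).prod := by
  induction h with
  | nil => simp
  | cons x _ ih => rcases ih with ih | ih <;> simp [ih]
  | swap x y l =>
    right
    simp only [List.map_cons, List.prod_cons, ← mul_assoc]
    rw [eq_neg_of_add_eq_zero_left (ExteriorAlgebra.ι_add_mul_swap (R := R) (v y) (v x)), neg_mul]
  | trans _ _ ih ih' => rcases ih with ih | ih <;> rcases ih' with ih' | ih' <;> simp [ih, ih']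

theorem prod_map_ι_eq_zero_of_not_nodup (v : α → V) {l : List α} (h : ¬ l.Nodup) :
    (l.map fun x => ExteriorAlgebra.ι R (v x)).prod = 0 := by
  have h' : ¬ Function.Injective fun i => v (l.get i) := fun hi =>
    h (List.nodup_iff_injective_get.2 hi.of_comp)
  have := ExteriorAlgebra.ιMulti_eq_zero_of_not_inj (R := R) h'
  rwa [ExteriorAlgebra.ιMulti_apply,
    ← Function.comp_def (fun x => ExteriorAlgebra.ι R (v x)) l.get, ← List.map_ofFn,
    List.ofFn_get] at this

theorem prod_map_ι_mul_comm (v : α → V) (l l' : List α) :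
    (l.map fun x => ExteriorAlgebra.ι R (v x)).prod *
        (l'.map fun x => ExteriorAlgebra.ι R (v x)).prod =
      (-1 : ExteriorAlgebra R V) ^ (l.length * l'.length) *
        ((l'.map fun x => ExteriorAlgebra.ι R (v x)).prod *
          (l.map fun x => ExteriorAlgebra.ι R (v x)).prod) := by
  have key : ∀ (x : α) (l' : List α), ExteriorAlgebra.ι R (v x) *
      (l'.map fun x => ExteriorAlgebra.ι R (v x)).prod = (-1 : ExteriorAlgebra R V) ^ l'.length *
      ((l'.map fun x => ExteriorAlgebra.ι R (v x)).prod * ExteriorAlgebra.ι R (v x)) := by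
    intro x l'
    induction l' with
    | nil => simp
    | cons y l' ih =>
      simp only [List.map_cons, List.prod_cons, List.length_cons, ← mul_assoc]
      rw [eq_neg_of_add_eq_zero_left (ExteriorAlgebra.ι_add_mul_swap (R := R) (v x) (v y)),
        neg_mul, mul_assoc, ih, pow_succ]
      rw [((Commute.neg_one_left (ExteriorAlgebra.ι R (v y))).pow_left _).symm.left_comm]
      simp [mul_assoc]
  induction l with
  | nil => simp
  | cons x l ih =>
    simp only [List.map_cons, List.prod_cons, List.length_cons]
    rw [mul_assoc, ih, ((Commute.neg_one_left _).pow_left _).symm.left_comm,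
      ← mul_assoc (ExteriorAlgebra.ι R (v x)), key, add_mul, one_mul, pow_add]
    simp only [mul_assoc]

/-- A square-free monomial, its factors in any order, is a unit multiple of (in fact `±`) an element
of the monomial basis of the exterior algebra. -/
theorem prod_map_ι_eq_smul_basis [LinearOrder α] (b : Module.Basis α R V) {l : List α}
    (hl : l.Nodup) :
    ∃ u : Rˣ, (l.map fun x => ExteriorAlgebra.ι R (b x)).prod =
      u • b.ExteriorAlgebra l.toFinset := by
  let o : List α := List.ofFn (l.toFinset.orderEmbOfFin rfl)
  have hb : b.ExteriorAlgebra l.toFinset = (o.map fun x => ExteriorAlgebra.ι R (b x)).prod := by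
    rw [ExteriorAlgebra.basis_apply_ofCard b rfl, ExteriorAlgebra.ιMulti_family,
      ExteriorAlgebra.ιMulti_apply, List.map_ofFn]
    rfl
  have hp : l.Perm o := by
    refine List.perm_of_nodup_nodup_toFinset_eq hl
      (List.nodup_ofFn.2 (l.toFinset.orderEmbOfFin rfl).injective) ?_
    ext x
    rw [List.mem_toFinset (l := o), List.mem_ofFn', Finset.range_orderEmbOfFin]
    rfl
  rw [hb]
  rcases prod_map_ι_eq_or_neg_of_perm (R := R) b hp with h | h
  · exact ⟨1, by simpa using h⟩
  · exact ⟨-1, by simpa using h⟩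

/-- Square-free monomials in pairwise different sets of generators admit a dual family of linear
forms. -/
theorem exists_dual_prod_map_ι (b : Module.Basis α R V) {κ : Type*} [DecidableEq κ]
    (w : κ → List α) (hw : ∀ k, (w k).Nodup) (hinj : ∀ k k', (w k).Perm (w k') → k = k') :
    ∃ φ : κ → ExteriorAlgebra R V →ₗ[R] R, ∀ k k',
      φ k ((w k').map fun x => ExteriorAlgebra.ι R (b x)).prod = if k = k' then 1 else 0 := by
  classical
  -- The order serves only to fix the signs of the monomial basis; any order will do.
  let _ : LinearOrder α := linearOrderOfSTO WellOrderingRel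
  choose u hu using fun k => prod_map_ι_eq_smul_basis (R := R) b (hw k)
  refine ⟨fun k => (↑(u k)⁻¹ : R) • b.ExteriorAlgebra.coord (w k).toFinset, fun k k' => ?_⟩
  rw [hu k']
  by_cases h : k = k'
  · subst h
    simp [Units.smul_def]
  · have : (w k').toFinset ≠ (w k).toFinset := fun h' => h
      (hinj k k' (List.perm_of_nodup_nodup_toFinset_eq (hw k) (hw k') h'.symm))
    simp [Units.smul_def, h, Finsupp.single_eq_of_ne this.symm]

end Exterior

/-! ### Multi-ghosts and the Maurer-Cartan equations -/

section Multighosts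

variable {n : ℕ} {P : Type*} [TopologicalSpace P] [ChartedSpace (EuclideanSpace ℝ (Fin n)) P]
  {𝕜 : Type*} [RCLike 𝕜] {M : ℕ}

variable (n P 𝕜 M) in
/-- The free generators of the complex: `Sum.inl a` indexes `P_a` and `Sum.inr b` indexes `η^b`. -/
noncomputable abbrev generatorBasis :
    Module.Basis (Fin M ⊕ Fin M) (SmoothFun n P 𝕜) (Fin M ⊕ Fin M → SmoothFun n P 𝕜) :=
  Pi.basisFun (SmoothFun n P 𝕜) (Fin M ⊕ Fin M)

variable (n P 𝕜) in
/-- The product of the generators listed in a word, in the order of the word. -/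
noncomputable def monomial (l : List (Fin M ⊕ Fin M)) : GhostComplex n P 𝕜 M :=
  (l.map fun x => ExteriorAlgebra.ι (SmoothFun n P 𝕜) (generatorBasis n P 𝕜 M x)).prod

theorem monomial_append (l l' : List (Fin M ⊕ Fin M)) :
    monomial n P 𝕜 (l ++ l') = monomial n P 𝕜 l * monomial n P 𝕜 l' := by
  simp [monomial]

theorem monomial_map_inr_append_map_inl (l l' : List (Fin M)) :
    monomial n P 𝕜 (l.map Sum.inr ++ l'.map Sum.inl) =
      (l.map (ghost n P 𝕜)).prod * (l'.map (antighost n P 𝕜)).prod := by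
  simp only [monomial, List.map_append, List.map_map, List.prod_append, Function.comp_def,
    Pi.basisFun_apply]
  rfl

/-- The word of generators spelling the multi-ghost `ω^I`. -/
def MultiIndex.word (I : MultiIndex M) : List (Fin M ⊕ Fin M) :=
  (I.1.1.sort (· ≤ ·)).map Sum.inr ++ (I.1.2.sort (· ≤ ·)).reverse.map Sum.inl

theorem monomial_word (I : MultiIndex M) : monomial n P 𝕜 I.word = multiGhost n P 𝕜 I :=
  monomial_map_inr_append_map_inl _ _

theorem MultiIndex.mem_word_inr (I : MultiIndex M) (b : Fin M) :
    Sum.inr b ∈ I.word ↔ b ∈ I.1.1 := by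
  simp [MultiIndex.word]

theorem MultiIndex.mem_word_inl (I : MultiIndex M) (a : Fin M) :
    Sum.inl a ∈ I.word ↔ a ∈ I.1.2 := by
  simp [MultiIndex.word]

theorem MultiIndex.nodup_word (I : MultiIndex M) : I.word.Nodup := by
  refine List.nodup_append.2 ⟨(Finset.sort_nodup _ _).map Sum.inr_injective,
    (List.nodup_reverse.2 (Finset.sort_nodup _ _)).map Sum.inl_injective, ?_⟩
  simp

theorem MultiIndex.length_word (I : MultiIndex M) : I.word.length = 2 * I.1.2.card + 1 := by
  simp [MultiIndex.word, I.2]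
  ring

theorem MultiIndex.eq_of_word_perm {I J : MultiIndex M} (h : I.word.Perm J.word) : I = J := by
  refine Subtype.ext (Prod.ext (Finset.ext fun b => ?_) (Finset.ext fun a => ?_))
  · rw [← I.mem_word_inr, h.mem_iff, J.mem_word_inr]
  · rw [← I.mem_word_inl, h.mem_iff, J.mem_word_inl]

variable (n P 𝕜 M) in
/-- The multi-ghosts are linearly independent over `C^∞(P)`, in the form of a dual family. -/
theorem exists_dual_multiGhost :
    ∃ φ : MultiIndex M → GhostComplex n P 𝕜 M →ₗ[SmoothFun n P 𝕜] SmoothFun n P 𝕜,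
      ∀ I J, φ I (multiGhost n P 𝕜 J) = if I = J then 1 else 0 := by
  obtain ⟨φ, hφ⟩ := exists_dual_prod_map_ι (generatorBasis n P 𝕜 M) MultiIndex.word
    MultiIndex.nodup_word fun I J => MultiIndex.eq_of_word_perm
  exact ⟨φ, fun I J => by rw [← monomial_word]; exact hφ I J⟩

/-- Multi-ghosts anticommute, each being a product of an odd number of generators. -/
theorem multiGhost_mul_comm (I J : MultiIndex M) :
    multiGhost n P 𝕜 I * multiGhost n P 𝕜 J = -(multiGhost n P 𝕜 J * multiGhost n P 𝕜 I) := by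
  rw [← monomial_word, ← monomial_word, monomial, monomial, prod_map_ι_mul_comm, Odd.neg_one_pow,
    neg_one_mul]
  rw [I.length_word, J.length_word]
  exact (odd_two_mul_add_one _).mul (odd_two_mul_add_one _)

/-- A monomial with one more ghost than antighosts is zero or, up to sign, a multi-ghost. -/
theorem monomial_mem_span_multiGhost (b a : List (Fin M)) (h : b.length = a.length + 1) :
    monomial n P 𝕜 (b.map Sum.inr ++ a.map Sum.inl) ∈
      Submodule.span (SmoothFun n P 𝕜) (Set.range (multiGhost n P 𝕜 (M := M))) := by
  by_cases hnd : (b.map Sum.inr ++ a.map Sum.inl).Nodup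
  swap
  · rw [monomial, prod_map_ι_eq_zero_of_not_nodup (R := SmoothFun n P 𝕜) _ hnd]
    exact Submodule.zero_mem _
  have hb : b.Nodup := (List.nodup_append.1 hnd).1.of_map _
  have ha : a.Nodup := (List.nodup_append.1 hnd).2.1.of_map _
  let I : MultiIndex M := ⟨(b.toFinset, a.toFinset), by
    rw [List.toFinset_card_of_nodup hb, List.toFinset_card_of_nodup ha, h]⟩
  have hp : (b.map Sum.inr ++ a.map Sum.inl).Perm I.word := by
    refine (List.perm_ext_iff_of_nodup hnd I.nodup_word).2 ?_
    rintro (x | x)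
    · simp [I.mem_word_inl, I]
    · simp [I.mem_word_inr, I]
  have hI := Submodule.subset_span (R := SmoothFun n P 𝕜)
    (Set.mem_range_self (f := multiGhost n P 𝕜 (M := M)) I)
  rw [← monomial_word] at hI
  rcases prod_map_ι_eq_or_neg_of_perm (R := SmoothFun n P 𝕜) (generatorBasis n P 𝕜 M) hp with e | e
  · rw [monomial, e]; exact hI
  · rw [monomial, e]; exact Submodule.neg_mem _ hI

theorem ghostNumber_le {g : ℤ} {N : Submodule (SmoothFun n P 𝕜) (GhostComplex n P 𝕜 M)}
    (h : ∀ b a : List (Fin M), (b.length : ℤ) - a.length = g →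
      monomial n P 𝕜 (b.map Sum.inr ++ a.map Sum.inl) ∈ N) :
    ghostNumber n P 𝕜 M g ≤ N := by
  refine iSup_le fun p => iSup_le fun q => iSup_le fun hpq => Submodule.span_le.2 ?_
  rintro _ ⟨b, a, rfl⟩
  have := h (List.ofFn b) (List.ofFn a) (by simpa using hpq)
  rwa [monomial_map_inr_append_map_inl, List.map_ofFn, List.map_ofFn] at this

variable (n P 𝕜 M) in
theorem ghostNumber_one_le_span :
    ghostNumber n P 𝕜 M 1 ≤
      Submodule.span (SmoothFun n P 𝕜) (Set.range (multiGhost n P 𝕜 (M := M))) :=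
  ghostNumber_le fun b a h => monomial_mem_span_multiGhost b a (by omega)

variable (n P 𝕜 M) in
/-- Every element of ghost number two is a `C^∞(P)`-combination of products of two multi-ghosts: a
monomial with `p + 2` ghosts and `p` antighosts is its first ghost times a monomial with `p + 1`
ghosts and `p` antighosts. -/
theorem ghostNumber_two_le_span :
    ghostNumber n P 𝕜 M 2 ≤ Submodule.span (SmoothFun n P 𝕜)
      (Set.range fun IJ : MultiIndex M × MultiIndex M =>
        multiGhost n P 𝕜 IJ.1 * multiGhost n P 𝕜 IJ.2) := by
  refine ghostNumber_le fun b a h => ?_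
  -- Ghost number two forces at least two ghosts, so the word of ghosts is not empty.
  obtain _ | ⟨b₀, b⟩ := b
  · simp at h; omega
  have h₁ := monomial_mem_span_multiGhost (n := n) (P := P) (𝕜 := 𝕜) [b₀] [] rfl
  have h₂ := monomial_mem_span_multiGhost (n := n) (P := P) (𝕜 := 𝕜) b a
    (by simp at h; omega)
  have h₃ := Submodule.mul_mem_mul h₁ h₂
  rw [Submodule.span_mul_span, ← monomial_append] at h₃
  refine Submodule.span_mono ?_ h₃
  rintro _ ⟨_, ⟨I, rfl⟩, _, ⟨J, rfl⟩, rfl⟩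
  exact ⟨(I, J), rfl⟩

theorem multiGhost_mem_ghostNumber (I : MultiIndex M) :
    multiGhost n P 𝕜 I ∈ ghostNumber n P 𝕜 M 1 := by
  refine Submodule.mem_iSup_of_mem I.1.1.card (Submodule.mem_iSup_of_mem I.1.2.card
    (Submodule.mem_iSup_of_mem (by rw [I.2]; push_cast; ring) (Submodule.subset_span ?_)))
  refine ⟨fun i => (I.1.1.sort (· ≤ ·)).get (i.cast (by simp)),
    fun i => (I.1.2.sort (· ≤ ·)).reverse.get (i.cast (by simp)), ?_⟩
  rw [multiGhost]
  congr 2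
  · refine List.ext_get (by simp) fun i _ _ => by simp
  · refine List.ext_get (by simp) fun i _ _ => by simp

theorem ofFun_mem_ghostNumber (f : SmoothFun n P 𝕜) : ofFun M f ∈ ghostNumber n P 𝕜 M 0 := by
  rw [ofFun, Algebra.algebraMap_eq_smul_one]
  refine Submodule.smul_mem _ _ (Submodule.mem_iSup_of_mem 0 (Submodule.mem_iSup_of_mem 0
    (Submodule.mem_iSup_of_mem (by simp) (Submodule.subset_span ⟨Fin.elim0, Fin.elim0, by simp⟩))))

variable {S : GhostComplex n P 𝕜 M →ₗ[𝕜] GhostComplex n P 𝕜 M}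

theorem IsDifferential.apply_ofFun_mul (hS : IsDifferential S) (f g : SmoothFun n P 𝕜) :
    S (ofFun M (f * g)) = f • S (ofFun M g) + g • S (ofFun M f) := by
  have := hS.leibniz 0 _ (ofFun_mem_ghostNumber f) (ofFun M g)
  rw [ofFun, map_mul]
  change S (ofFun M f * ofFun M g) = _
  rw [this, Int.negOnePow_zero, Units.val_one, one_smul, add_comm, Algebra.smul_def,
    Algebra.smul_def, Algebra.commutes g]
  rfl

/-- The derivation `f ↦ φ (S f)` of `C^∞(P)` defined by a differential `S` and a linear form `φ`. -/
noncomputable def derivationOfDual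
    (φ : GhostComplex n P 𝕜 M →ₗ[SmoothFun n P 𝕜] SmoothFun n P 𝕜) (hS : IsDifferential S) :
    Derivation 𝕜 (SmoothFun n P 𝕜) (SmoothFun n P 𝕜) :=
  Derivation.mk' (φ.restrictScalars 𝕜 ∘ₗ S ∘ₗ
    (Algebra.linearMap (SmoothFun n P 𝕜) (GhostComplex n P 𝕜 M)).restrictScalars 𝕜) fun f g => by
      have := congrArg φ (hS.apply_ofFun_mul f g)
      simpa [ofFun] using this

/-- Raising the ghost number by one and the Leibniz rule on functions already make a differential
on the complex a Maurer-Cartan differential with respect to the multi-ghosts. -/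
theorem IsDifferential.isMaurerCartan (hS : IsDifferential S) : IsMaurerCartan S := by
  obtain ⟨φ, hφ⟩ := exists_dual_multiGhost n P 𝕜 M
  have hA : ∀ K : MultiIndex M, ∃ A : MultiIndex M × MultiIndex M → SmoothFun n P 𝕜,
      ∑ IJ, A IJ • (multiGhost n P 𝕜 IJ.1 * multiGhost n P 𝕜 IJ.2) =
        S (multiGhost n P 𝕜 K) := fun K =>
    (Submodule.mem_span_range_iff_exists_fun _).1
      (ghostNumber_two_le_span n P 𝕜 M (hS.ghostNumber 1 _ (multiGhost_mem_ghostNumber K)))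
  choose A hA using hA
  -- With `S ω^K = A_{IJ} ω^I ω^J`, antisymmetry of `ω^I ω^J` makes `A` count only through
  -- `(A_{IJ} - A_{JI}) / 2`, whence `C_{IJ} = A_{JI} - A_{IJ}`.
  refine ⟨hS, fun I => derivationOfDual (φ I) hS, fun I J K => A K (J, I) - A K (I, J),
    fun I J K => by ring, fun f => ?_, fun K => ?_⟩
  · obtain ⟨c, hc⟩ := (Submodule.mem_span_range_iff_exists_fun _).1
      (ghostNumber_one_le_span n P 𝕜 M (hS.ghostNumber 0 _ (ofFun_mem_ghostNumber f)))
    have hρ : ∀ I, derivationOfDual (φ I) hS f = c I := fun I => by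
      change φ I (S (ofFun M f)) = c I
      simp [← hc, hφ]
    simp [hρ, hc]
  · have hswap : ∑ I, ∑ J, A K (J, I) • (multiGhost n P 𝕜 I * multiGhost n P 𝕜 J) =
        -∑ I, ∑ J, A K (I, J) • (multiGhost n P 𝕜 I * multiGhost n P 𝕜 J) := by
      rw [Finset.sum_comm, ← Finset.sum_neg_distrib]
      refine Finset.sum_congr rfl fun I _ => ?_
      rw [← Finset.sum_neg_distrib]
      refine Finset.sum_congr rfl fun J _ => ?_
      rw [multiGhost_mul_comm J I, smul_neg]
    simp only [sub_smul, Finset.sum_sub_distrib]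
    rw [hswap, ← hA K, Fintype.sum_prod_type]
    module

end Multighosts

end BRST

theorem theorem1 {n M : ℕ} {P : Type*} [TopologicalSpace P] [T2Space P] [SecondCountableTopology P]
    [ChartedSpace (EuclideanSpace ℝ (Fin n)) P] [IsManifold (𝓡 n) ∞ P] {𝕜 : Type*} [RCLike 𝕜]
    (σ : BRST.SymplecticForm n P) (G : Fin M → BRST.SmoothFun n P ℝ)
    (C : Fin M → Fin M → Fin M → BRST.SmoothFun n P 𝕜)
    (hG : BRST.IsFirstClass σ G C) (hirr : BRST.IsIrreducible G)
    (S : BRST.GhostComplex n P 𝕜 M →ₗ[𝕜] BRST.GhostComplex n P 𝕜 M)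
    (hS : BRST.IsBRSTDifferential σ G C S) :
    BRST.IsMaurerCartan S := by
  exact hS.isDifferential.isMaurerCartan
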